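/- Let $M$ be a closed connected smooth manifold with base point $x_0$, let $\pi=\pi_1(M,x_0)$ and let $u\in H^1(M;\mathbf R)\cong \mathrm{Hom}(\pi,\mathbf R)$. Put $\Lambda=\mathbf Z[\pi]$, and let $\Lambda_u$ be the completed ring of all formal series $\lambda=\sum_{g\in\pi} n_g\,g$ with $n_g\in\mathbf Z$ such that for every $A\in\mathbf R$ there are only finitely many $g\in\pi$ with $n_g\neq 0$ and $u(g)<A$. Fix a $\mathcal C^1$-triangulation of $M$ and lift it to the universal cover $\widetilde M$; let $C_\bullet(M)$ be the simplicial chain complex of $\widetilde M$ with respect to the lifted triangulation, a complex of left $\Lambda$-modules through the action of $\pi$ by deck transformations. The Novikov homology $H_*(M,u)$ is the homology of the complex $C_\bullet(M,u)=\Lambda_u\otimes_\Lambda C_\bullet(M)$ of left $\Lambda_u$-modules. If $H_i(M,u)=0$ for all $i\ge 0$, for some class $u$, then the Euler characteristic $\chi(M)=\sum_{i\ge 0}(-1)^i\,\mathrm{rank}\,H_i(M;\mathbf Z)$ is zero, where $H_*(M;\mathbf Z)$ is the simplicial homology of the triangulation. -/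

import Mathlib

noncomputable section

namespace Novikov

section Ring

variable {G : Type*} [Group G]

/-- `u(gᵢ) → +∞` along the support of the formal series `∑ a(g) g`: for every `A`, only finitely many
group elements with `u(g) < A` appear with a non-zero coefficient. -/
def TendsToInfinity (u : G →* Multiplicative ℝ) (a : G → ℤ) : Prop :=
  ∀ A : ℝ, {g : G | a g ≠ 0 ∧ (u g).toAdd < A}.Finite

/-- The formal series over `G` along which `u` tends to `+∞`, as a subgroup of `ℤ[[G]] = (G → ℤ)`. -/
def novikovSubgroup (u : G →* Multiplicative ℝ) : AddSubgroup (G → ℤ) where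
  carrier := {a | TendsToInfinity u a}
  zero_mem' A := by simp
  add_mem' {a b} ha hb A := by
    refine ((ha A).union (hb A)).subset ?_
    rintro g ⟨hg, hA⟩
    by_cases h : a g = 0
    · exact Or.inr ⟨fun h' => hg (by simp [h, h']), hA⟩
    · exact Or.inl ⟨h, hA⟩
  neg_mem' {a} ha A := by simpa using ha A

/-- The completed ring `Λ_u` of the group ring `Λ = ℤ[G]` with respect to `u : G → ℝ`. -/
def NovikovRing (u : G →* Multiplicative ℝ) : Type _ := novikovSubgroup u

namespace NovikovRing

variable {u : G →* Multiplicative ℝ}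

instance : AddCommGroup (NovikovRing u) := inferInstanceAs (AddCommGroup (novikovSubgroup u))

/-- The coefficient of `g` in a formal series. -/
def coeff (a : NovikovRing u) (g : G) : ℤ := a.1 g

@[ext] theorem ext {a b : NovikovRing u} (h : ∀ g, a.coeff g = b.coeff g) : a = b :=
  Subtype.ext (funext h)

@[simp] theorem coeff_add (a b : NovikovRing u) (g : G) : (a + b).coeff g = a.coeff g + b.coeff g :=
  rfl

@[simp] theorem coeff_zero (g : G) : (0 : NovikovRing u).coeff g = 0 := rfl

theorem finite (a : NovikovRing u) (A : ℝ) : {g : G | a.coeff g ≠ 0 ∧ (u g).toAdd < A}.Finite :=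
  a.2 A

theorem exists_lower_bound (a : NovikovRing u) : ∃ B : ℝ, ∀ g, a.coeff g ≠ 0 → B ≤ (u g).toAdd := by
  obtain ⟨B, hB⟩ := ((a.finite 0).image fun g => (u g).toAdd).bddBelow
  refine ⟨min B 0, fun g hg => ?_⟩
  by_cases h : (u g).toAdd < 0
  · exact (min_le_left _ _).trans (hB ⟨g, ⟨hg, h⟩, rfl⟩)
  · exact (min_le_right _ _).trans (not_lt.1 h)

theorem finite_pairs (a b : NovikovRing u) (A : ℝ) :
    {q : G × G | a.coeff q.1 ≠ 0 ∧ b.coeff q.2 ≠ 0 ∧ (u (q.1 * q.2)).toAdd < A}.Finite := by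
  obtain ⟨B, hB⟩ := a.exists_lower_bound
  obtain ⟨C, hC⟩ := b.exists_lower_bound
  refine ((a.finite (A - C)).prod (b.finite (A - B))).subset ?_
  rintro ⟨x, y⟩ ⟨hx, hy, h⟩
  have h1 := hB x hx
  have h2 := hC y hy
  simp only [map_mul, toAdd_mul] at h
  exact ⟨⟨hx, by linarith⟩, ⟨hy, by linarith⟩⟩

theorem finite_factorizations (a b : NovikovRing u) (g : G) :
    (fun h => a.coeff h * b.coeff (h⁻¹ * g)).HasFiniteSupport := by
  refine Set.Finite.of_finite_image (f := fun h => (h, h⁻¹ * g)) ?_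
    (fun x _ y _ h => (Prod.mk.inj h).1)
  refine (finite_pairs a b ((u g).toAdd + 1)).subset ?_
  rintro _ ⟨h, hh, rfl⟩
  exact ⟨left_ne_zero_of_mul hh, right_ne_zero_of_mul hh, by simp⟩

/-- The product of formal series: the coefficient of `g` in `a * b` is `∑_{xy = g} a(x) b(y)`, a sum
with finitely many non-zero terms. -/
instance : Mul (NovikovRing u) where
  mul a b := ⟨fun g => ∑ᶠ h : G, a.coeff h * b.coeff (h⁻¹ * g), fun A => by
    refine ((finite_pairs a b A).image fun q => q.1 * q.2).subset ?_
    rintro g ⟨hg, hA⟩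
    obtain ⟨h, hh⟩ := not_forall.1 (mt finsum_eq_zero_of_forall_eq_zero hg)
    exact ⟨(h, h⁻¹ * g), ⟨left_ne_zero_of_mul hh, right_ne_zero_of_mul hh, by simpa using hA⟩,
      by simp⟩⟩

theorem coeff_mul (a b : NovikovRing u) (g : G) :
    (a * b).coeff g = ∑ᶠ h : G, a.coeff h * b.coeff (h⁻¹ * g) := rfl

open Classical in
/-- The group element `g` as a formal series. -/
def single (u : G →* Multiplicative ℝ) (g : G) : NovikovRing u :=
  ⟨Pi.single g 1, fun A => (Set.finite_singleton g).subset (by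
    rintro h ⟨hh, -⟩
    by_contra hne
    exact hh (Pi.single_eq_of_ne hne 1))⟩

open Classical in
theorem coeff_single_self (g : G) : (single u g).coeff g = 1 := Pi.single_eq_same g 1

open Classical in
theorem coeff_single_of_ne {g h : G} (hne : h ≠ g) : (single u g).coeff h = 0 :=
  Pi.single_eq_of_ne hne 1

instance : One (NovikovRing u) := ⟨single u 1⟩

theorem one_def : (1 : NovikovRing u) = single u 1 := rfl

theorem coeff_single_mul (g : G) (a : NovikovRing u) (h : G) :
    (single u g * a).coeff h = a.coeff (g⁻¹ * h) := by
  rw [coeff_mul, finsum_eq_single _ g, coeff_single_self, one_mul]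
  intro x hx
  rw [coeff_single_of_ne hx, zero_mul]

theorem coeff_mul_single (g : G) (a : NovikovRing u) (h : G) :
    (a * single u g).coeff h = a.coeff (h * g⁻¹) := by
  rw [coeff_mul, finsum_eq_single _ (h * g⁻¹)]
  · rw [show (h * g⁻¹)⁻¹ * h = g by group, coeff_single_self, mul_one]
  · intro x hx
    rw [coeff_single_of_ne, mul_zero]
    rintro rfl
    exact hx (by group)

theorem mul_assoc' (a b c : NovikovRing u) : a * b * c = a * (b * c) := by
  ext g
  have hfin : (fun q : G × G => a.coeff q.1 * b.coeff (q.1⁻¹ * q.2) * c.coeff (q.2⁻¹ * g)).HasFiniteSupport := by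
    obtain ⟨C, hC⟩ := c.exists_lower_bound
    refine Set.Finite.of_finite_image (f := fun q : G × G => (q.1, q.1⁻¹ * q.2)) ?_ ?_
    · refine (finite_pairs a b ((u g).toAdd - C + 1)).subset ?_
      rintro _ ⟨⟨x, y⟩, hxy, rfl⟩
      have hc := hC _ (right_ne_zero_of_mul hxy)
      have hab := left_ne_zero_of_mul hxy
      refine ⟨left_ne_zero_of_mul hab, right_ne_zero_of_mul hab, ?_⟩
      simp only [map_mul, map_inv, toAdd_mul, toAdd_inv] at hc ⊢
      linarith
    · rintro ⟨x, y⟩ - ⟨x', y'⟩ - h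
      obtain ⟨rfl, h2⟩ := Prod.mk.inj h
      simpa using h2
  have hfin' := hfin
  simp only [coeff_mul, finsum_mul, mul_finsum]
  have e1 := finsum_curry _ hfin
  have e2 := finsum_curry (fun q : G × G => a.coeff q.2 * b.coeff (q.2⁻¹ * q.1) * c.coeff (q.1⁻¹ * g))
    (hfin.preimage ((Equiv.prodComm G G).injective.injOn))
  have e3 := finsum_comp_equiv (Equiv.prodComm G G)
    (f := fun q : G × G => a.coeff q.1 * b.coeff (q.1⁻¹ * q.2) * c.coeff (q.2⁻¹ * g))
  refine (e2.symm.trans (e3.trans e1)).trans (finsum_congr fun x => ?_)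
  rw [← finsum_comp_equiv (Equiv.mulLeft x)]
  refine finsum_congr fun y => ?_
  simp [mul_assoc]

instance : Ring (NovikovRing u) where
  left_distrib a b c := by
    ext g
    simp only [coeff_mul, coeff_add, mul_add]
    exact finsum_add_distrib (finite_factorizations a b g) (finite_factorizations a c g)
  right_distrib a b c := by
    ext g
    simp only [coeff_mul, coeff_add, add_mul]
    exact finsum_add_distrib (finite_factorizations a c g) (finite_factorizations b c g)
  zero_mul a := by ext g; simp [coeff_mul]
  mul_zero a := by ext g; simp [coeff_mul]
  mul_assoc := mul_assoc'
  one_mul a := by ext g; simp [one_def, coeff_single_mul]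
  mul_one a := by ext g; simp [one_def, coeff_mul_single]
  zsmul := (inferInstance : AddCommGroup (NovikovRing u)).zsmul
  zsmul_zero' := (inferInstance : AddCommGroup (NovikovRing u)).zsmul_zero'
  zsmul_succ' := (inferInstance : AddCommGroup (NovikovRing u)).zsmul_succ'
  zsmul_neg' := (inferInstance : AddCommGroup (NovikovRing u)).zsmul_neg'
  neg_add_cancel := (inferInstance : AddCommGroup (NovikovRing u)).neg_add_cancel

/-- Group elements multiply in `Λ_u` as they do in `G`. -/
def singleHom (u : G →* Multiplicative ℝ) : G →* NovikovRing u where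
  toFun := single u
  map_one' := rfl
  map_mul' g h := by
    ext x
    rw [coeff_single_mul]
    by_cases hx : x = g * h
    · subst hx
      rw [coeff_single_self, inv_mul_cancel_left, coeff_single_self]
    · rw [coeff_single_of_ne hx, coeff_single_of_ne]
      rintro rfl
      exact hx (by group)

/-- The inclusion of the group ring `Λ = ℤ[G]` into `Λ_u`. -/
def ofGroupRing (u : G →* Multiplicative ℝ) : MonoidAlgebra ℤ G →+* NovikovRing u :=
  (MonoidAlgebra.lift ℤ (NovikovRing u) G (singleHom u)).toRingHom

end NovikovRing

end Ring

section BaseChange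

open TensorProduct CategoryTheory

universe w w₁ w₂

variable {R : Type w₁} {S : Type w₂} [Ring R] [Ring S] (f : R →+* S)

/-- The relations `(s · f(r)) ⊗ c = s ⊗ (r c)` in `S ⊗_ℤ C`. -/
def balancingRelations (C : Type*) [AddCommGroup C] [Module R C] : Submodule S (S ⊗[ℤ] C) :=
  Submodule.span S {z | ∃ (s : S) (r : R) (c : C), z = (s * f r) ⊗ₜ[ℤ] c - s ⊗ₜ[ℤ] (r • c)}

/-- The left `S`-module `S ⊗_R C`, for a homomorphism `f : R → S` of not necessarily commutative rings
and a left `R`-module `C`. -/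
def BaseChange (C : Type*) [AddCommGroup C] [Module R C] : Type _ :=
  (S ⊗[ℤ] C) ⧸ balancingRelations f C

instance (C : Type*) [AddCommGroup C] [Module R C] : AddCommGroup (BaseChange f C) :=
  inferInstanceAs (AddCommGroup ((S ⊗[ℤ] C) ⧸ balancingRelations f C))

instance (C : Type*) [AddCommGroup C] [Module R C] : Module S (BaseChange f C) :=
  inferInstanceAs (Module S ((S ⊗[ℤ] C) ⧸ balancingRelations f C))

namespace BaseChange

variable {C D E : Type*} [AddCommGroup C] [Module R C] [AddCommGroup D] [Module R D]
  [AddCommGroup E] [Module R E]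

/-- The class of `s ⊗ c` in `S ⊗_R C`. -/
def tmul (s : S) (c : C) : BaseChange f C := (balancingRelations f C).mkQ (s ⊗ₜ[ℤ] c)

/-- The map `id ⊗ g : S ⊗_R C → S ⊗_R D`. -/
def map (g : C →ₗ[R] D) : BaseChange f C →ₗ[S] BaseChange f D :=
  (balancingRelations f C).mapQ (balancingRelations f D)
    (TensorProduct.AlgebraTensorModule.map LinearMap.id g.toAddMonoidHom.toIntLinearMap) (by
      refine Submodule.span_le.2 ?_
      rintro _ ⟨s, r, c, rfl⟩
      refine Submodule.subset_span ⟨s, r, g c, ?_⟩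
      simp)

@[simp] theorem map_tmul (g : C →ₗ[R] D) (s : S) (c : C) :
    map f g (tmul f s c) = tmul f s (g c) := rfl

theorem hom_ext {N : Type*} [AddCommGroup N] [Module S N] {φ ψ : BaseChange f C →ₗ[S] N}
    (h : ∀ s c, φ (tmul f s c) = ψ (tmul f s c)) : φ = ψ := by
  refine Submodule.linearMap_qext _ (TensorProduct.AlgebraTensorModule.ext fun s c => h s c)

theorem map_id : map f (LinearMap.id : C →ₗ[R] C) = LinearMap.id :=
  hom_ext f fun _ _ => rfl

theorem map_comp (h : D →ₗ[R] E) (g : C →ₗ[R] D) : map f (h ∘ₗ g) = map f h ∘ₗ map f g :=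
  hom_ext f fun _ _ => rfl

theorem map_add (g h : C →ₗ[R] D) : map f (g + h) = map f g + map f h :=
  hom_ext f fun s c => by
    have : tmul f s (g c + h c) = tmul f s (g c) + tmul f s (h c) := by
      simp only [tmul, TensorProduct.tmul_add, _root_.map_add]
      rfl
    simpa using this

end BaseChange

/-- The functor `S ⊗_R -` from left `R`-modules to left `S`-modules. -/
def baseChangeFunctor : ModuleCat.{w} R ⥤ ModuleCat.{max w₂ w} S where
  obj C := ModuleCat.of S (BaseChange f C)
  map g := ModuleCat.ofHom (BaseChange.map f g.hom)
  map_id C := by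
    ext1
    exact BaseChange.map_id f
  map_comp g h := by
    ext1
    exact BaseChange.map_comp f h.hom g.hom

instance : (baseChangeFunctor.{w} f).Additive where
  map_add {_ _ g h} := by
    ext1
    exact BaseChange.map_add f g.hom h.hom

end BaseChange

section Chains

open CategoryTheory

universe v w

/-- A sequence of sets of (ordered) simplices with face maps: a `Δ`-complex. -/
structure DeltaSet where
  /-- The set of `n`-simplices. -/
  simplex : ℕ → Type v
  /-- The `i`-th face of an `(n+1)`-simplex. -/
  face : ∀ {n : ℕ}, Fin (n + 2) → simplex (n + 1) → simplex n
  face_face : ∀ {n : ℕ} (x : simplex (n + 2)) (i j : Fin (n + 2)), i ≤ j →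
    face i (face j.succ x) = face j (face i.castSucc x)

namespace DeltaSet

variable (X : DeltaSet.{v})

/-- The boundary `∂x = ∑ (-1)ⁱ dᵢ x`. -/
def boundary (n : ℕ) : (X.simplex (n + 1) →₀ ℤ) →ₗ[ℤ] (X.simplex n →₀ ℤ) :=
  ∑ i : Fin (n + 2), (-1 : ℤ) ^ (i : ℕ) • Finsupp.lmapDomain ℤ ℤ (X.face i)

theorem boundary_boundary (n : ℕ) : X.boundary n ∘ₗ X.boundary (n + 1) = 0 := by
  refine Finsupp.lhom_ext' fun x => LinearMap.ext_ring ?_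
  simp only [boundary, LinearMap.comp_apply, LinearMap.sum_apply, LinearMap.smul_apply,
    Finsupp.lsingle_apply, Finsupp.lmapDomain_apply, Finsupp.mapDomain_single, map_sum, map_smul,
    LinearMap.zero_apply, Finset.smul_sum, smul_smul]
  rw [← Finset.sum_product', Finset.univ_product_univ]
  let S : Finset (Fin (n + 3) × Fin (n + 2)) := {q | (q.1 : ℕ) ≤ q.2}
  rw [← Finset.sum_add_sum_compl S, ← eq_neg_iff_add_eq_zero, ← Finset.sum_neg_distrib]
  refine Finset.sum_bij
    (fun q hq => (q.2.succ, q.1.castLT (lt_of_le_of_lt (Finset.mem_filter.1 hq).2 q.2.2))) ?_ ?_ ?_ ?_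
  · rintro ⟨i, j⟩ hq
    simp [S] at hq ⊢
    omega
  · rintro ⟨i, j⟩ hq ⟨i', j'⟩ hq' h
    simp [Fin.ext_iff] at h ⊢
    omega
  · rintro ⟨i, j⟩ hq
    simp [S] at hq
    refine ⟨(j.castSucc, i.pred ?_), ?_, ?_⟩
    · rintro rfl
      simp at hq
    · simp [S]
      omega
    · simp
  · rintro ⟨i, j⟩ hq
    have hle : i.castLT (lt_of_le_of_lt (Finset.mem_filter.1 hq).2 j.2) ≤ j :=
      Fin.le_def.2 (Finset.mem_filter.1 hq).2
    have := X.face_face x _ j hle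
    simp only [Fin.castSucc_castLT] at this
    simp only [this, Fin.val_succ, Fin.val_castLT, pow_succ, ← neg_smul]
    congr 1
    ring

/-- The chain complex of integral chains of a `Δ`-complex. -/
def chainComplex : ChainComplex (ModuleCat.{v} ℤ) ℕ :=
  ChainComplex.of (fun n => ModuleCat.of ℤ (X.simplex n →₀ ℤ))
    (fun n => ModuleCat.ofHom (X.boundary n)) (fun n => by
      ext1
      exact X.boundary_boundary n)

end DeltaSet

/-- A `Δ`-complex with an action of `G` by automorphisms. -/
structure EquivariantDeltaSet (G : Type w) [Group G] extends DeltaSet.{v} where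
  action : ∀ n, MulAction G (simplex n)
  face_smul : ∀ {n : ℕ} (i : Fin (n + 2)) (g : G) (x : simplex (n + 1)),
    face i (g • x) = g • face i x

attribute [instance] EquivariantDeltaSet.action

/-- The permutation representation of `G` on the free abelian group on a `G`-set `X`. -/
def permRep (G : Type*) [Group G] (X : Type*) [MulAction G X] : Representation ℤ G (X →₀ ℤ) where
  toFun g := Finsupp.lmapDomain ℤ ℤ (g • ·)
  map_one' := by
    refine Finsupp.lhom_ext' fun x => LinearMap.ext_ring ?_
    simp
  map_mul' g h := by
    refine Finsupp.lhom_ext' fun x => LinearMap.ext_ring ?_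
    simp [mul_smul]

namespace EquivariantDeltaSet

variable {G : Type w} [Group G] (X : EquivariantDeltaSet.{v} G)

theorem boundary_permRep (n : ℕ) (g : G) (c : X.simplex (n + 1) →₀ ℤ) :
    X.boundary n (permRep G _ g c) = permRep G _ g (X.boundary n c) := by
  suffices h : X.boundary n ∘ₗ permRep G _ g = permRep G _ g ∘ₗ X.boundary n from
    LinearMap.congr_fun h c
  refine Finsupp.lhom_ext' fun x => LinearMap.ext_ring ?_
  simp [DeltaSet.boundary, permRep, X.face_smul]

/-- The boundary as a homomorphism of modules over the group ring. -/
def equivariantBoundary (n : ℕ) : (permRep G (X.simplex (n + 1))).asModule →ₗ[MonoidAlgebra ℤ G]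
    (permRep G (X.simplex n)).asModule :=
  MonoidAlgebra.equivariantOfLinearOfComm
    ((permRep G (X.simplex n)).asModuleEquiv.symm.toLinearMap ∘ₗ X.boundary n ∘ₗ
      (permRep G (X.simplex (n + 1))).asModuleEquiv.toLinearMap) (fun g c => by
      apply (permRep G (X.simplex n)).asModuleEquiv.injective
      simp only [Representation.asModuleEquiv_map_smul, Representation.asAlgebraHom_single_one,
        LinearMap.comp_apply, LinearEquiv.coe_coe]
      exact X.boundary_permRep n g c)

/-- The chain complex of `X` as a complex of left `ℤ[G]`-modules. -/
def equivariantChainComplex : ChainComplex (ModuleCat.{v} (MonoidAlgebra ℤ G)) ℕ :=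
  ChainComplex.of (fun n => ModuleCat.of (MonoidAlgebra ℤ G) (permRep G (X.simplex n)).asModule)
    (fun n => ModuleCat.ofHom (X.equivariantBoundary n)) (fun n => by
      ext1
      exact LinearMap.ext fun c => LinearMap.congr_fun (X.boundary_boundary n) c)

/-- The complex `Λ_u ⊗_Λ C_•`, where `Λ = ℤ[G]` and `C_•` is the chain complex of `X`. -/
def completedChainComplex (u : G →* Multiplicative ℝ) :
    ChainComplex (ModuleCat.{max w v} (NovikovRing u)) ℕ :=
  ((baseChangeFunctor.{v} (NovikovRing.ofGroupRing u)).mapHomologicalComplex _).obj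
    X.equivariantChainComplex

end EquivariantDeltaSet

end Chains

section UniversalCover

universe v w

/-- The fundamental group with the product `γ γ' = γ followed by γ'` (Mathlib composes loops in the
other order). -/
abbrev PiOne (X : Type*) [TopologicalSpace X] (x₀ : X) : Type _ := (FundamentalGroup X x₀)ᵐᵒᵖ

/-- A universal covering of `X`, with a base point above `x₀`. -/
structure UniversalCover (X : Type v) [TopologicalSpace X] (x₀ : X) where
  /-- The total space. -/
  space : Type w
  [topology : TopologicalSpace space]
  [simplyConnected : SimplyConnectedSpace space]
  /-- The covering projection. -/
  proj : space → X
  isCoveringMap : IsCoveringMap proj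
  /-- The base point. -/
  base : space
  proj_base : proj base = x₀

attribute [instance] UniversalCover.topology UniversalCover.simplyConnected

namespace UniversalCover

variable {X : Type v} [TopologicalSpace X] {x₀ : X} (U : UniversalCover.{v, w} X x₀)

instance [LocallyPathConnectedSpace X] : LocallyPathConnectedSpace U.space :=
  letI : ChartedSpace X U.space :=
    { atlas := Set.univ
      chartAt := fun e => (U.isCoveringMap.isLocalHomeomorph e).choose
      mem_chart_source := fun e => (U.isCoveringMap.isLocalHomeomorph e).choose_spec.1
      chart_mem_atlas := fun _ => Set.mem_univ _ }
  ChartedSpace.locallyPathConnectedSpace X U.space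

/-- The end point of the lift of the loop `γ` that starts at the base point. -/
def endpoint (γ : PiOne X x₀) : U.space :=
  (U.isCoveringMap.monodromy (x := x₀) (y := x₀) γ.unop ⟨U.base, U.proj_base⟩).1

theorem proj_endpoint (γ : PiOne X x₀) : U.proj (U.endpoint γ) = x₀ :=
  (U.isCoveringMap.monodromy (x := x₀) (y := x₀) γ.unop ⟨U.base, U.proj_base⟩).2

variable [LocallyPathConnectedSpace X]

theorem existsUnique_deck (γ : PiOne X x₀) :
    ∃! F : C(U.space, U.space), F U.base = U.endpoint γ ∧ U.proj ∘ F = U.proj :=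
  U.isCoveringMap.existsUnique_continuousMap_lifts ⟨U.proj, U.isCoveringMap.continuous⟩ U.base
    (U.endpoint γ) ((U.proj_endpoint γ).trans U.proj_base.symm)

/-- The deck transformation of `γ`: the map over `X` that sends the base point to the end point of
the lift of `γ`. -/
def deck (γ : PiOne X x₀) : C(U.space, U.space) := (U.existsUnique_deck γ).choose

theorem deck_base (γ : PiOne X x₀) : U.deck γ U.base = U.endpoint γ :=
  (U.existsUnique_deck γ).choose_spec.1.1

theorem proj_comp_deck (γ : PiOne X x₀) : U.proj ∘ U.deck γ = U.proj :=
  (U.existsUnique_deck γ).choose_spec.1.2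

theorem eq_deck {γ : PiOne X x₀} {F : C(U.space, U.space)} (h : F U.base = U.endpoint γ)
    (h' : U.proj ∘ F = U.proj) : F = U.deck γ :=
  (U.existsUnique_deck γ).choose_spec.2 F ⟨h, h'⟩

theorem deck_one : U.deck 1 = ContinuousMap.id _ := by
  refine (U.eq_deck ?_ rfl).symm
  exact congrArg Subtype.val (congrFun (U.isCoveringMap.monodromy_refl (x := x₀)) ⟨U.base, U.proj_base⟩).symm

theorem deck_endpoint (γ γ' : PiOne X x₀) : U.deck γ (U.endpoint γ') = U.endpoint (γ * γ') := by
  obtain ⟨γ⟩ := γ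
  obtain ⟨γ'⟩ := γ'
  change U.deck ⟨γ⟩ _ = (U.isCoveringMap.monodromy (x := x₀) (y := x₀)
    (Path.Homotopic.Quotient.trans γ γ') ⟨U.base, U.proj_base⟩).1
  rw [U.isCoveringMap.monodromy_trans_apply]
  have hb := U.deck_base ⟨γ⟩
  have hp := U.proj_comp_deck ⟨γ⟩
  set F := U.deck ⟨γ⟩
  change F U.base = (U.isCoveringMap.monodromy (x := x₀) (y := x₀) γ ⟨U.base, U.proj_base⟩).1 at hb
  revert hb
  generalize U.isCoveringMap.monodromy (x := x₀) (y := x₀) γ ⟨U.base, U.proj_base⟩ = e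
  intro hb
  obtain ⟨γ'⟩ := γ'
  change F (U.isCoveringMap.liftPath γ' U.base _ 1) = U.isCoveringMap.liftPath γ' e.1 _ 1
  have key : F.comp (U.isCoveringMap.liftPath γ' U.base (γ'.source.trans U.proj_base.symm)) =
      U.isCoveringMap.liftPath γ' e.1 (γ'.source.trans e.2.symm) := by
    rw [U.isCoveringMap.eq_liftPath_iff']
    refine ⟨?_, ?_⟩
    · rw [ContinuousMap.coe_comp, ← Function.comp_assoc, hp, U.isCoveringMap.liftPath_lifts]
    · rw [ContinuousMap.comp_apply, U.isCoveringMap.liftPath_zero, hb]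
  exact congrArg (fun H : C(unitInterval, U.space) => H 1) key

theorem deck_mul (γ γ' : PiOne X x₀) : U.deck (γ * γ') = (U.deck γ).comp (U.deck γ') := by
  refine (U.eq_deck ?_ ?_).symm
  · rw [ContinuousMap.comp_apply, U.deck_base, U.deck_endpoint]
  · rw [ContinuousMap.coe_comp, ← Function.comp_assoc, U.proj_comp_deck, U.proj_comp_deck]

end UniversalCover

end UniversalCover

section Triangulation

open scoped Manifold ContDiff

universe v w

/-- The closed simplex with vertex set `s`, inside the standard simplex on all vertices. -/
def closedSimplex {N : ℕ} (s : Finset (Fin N)) : Set (Fin N → ℝ) :=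
  {x | x ∈ stdSimplex ℝ (Fin N) ∧ ∀ i, x i ≠ 0 → i ∈ s}

/-- The geometric realization of a finite simplicial complex: the union of its closed simplices. -/
def realization {N : ℕ} (K : AbstractSimplicialComplex (Fin N)) : Set (Fin N → ℝ) :=
  {x | ∃ s ∈ K.faces, x ∈ closedSimplex s}

/-- A `C¹`-triangulation of a compact manifold: a homeomorphism from the realization of a finite
simplicial complex that is `C¹`, with injective differential, on each closed simplex. The vertices
are numbered, which orients the simplices. -/
structure Triangulation (d : ℕ) (M : Type v) [TopologicalSpace M]
    [ChartedSpace (EuclideanSpace ℝ (Fin d)) M] where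
  /-- The number of vertices. -/
  numVertices : ℕ
  /-- The simplicial complex. -/
  complex : AbstractSimplicialComplex (Fin numVertices)
  /-- The homeomorphism with `M`. -/
  homeo : realization complex ≃ₜ M
  contMDiff : ∀ s ∈ complex.faces, ∃ f : (Fin numVertices → ℝ) → M,
    (∀ x : realization complex, x.1 ∈ closedSimplex s → f x.1 = homeo x) ∧
    ContMDiffOn 𝓘(ℝ, Fin numVertices → ℝ) (𝓡 d) 1 f (closedSimplex s) ∧
    ∀ x ∈ closedSimplex s, ∀ y : Fin numVertices → ℝ, ∑ i, y i = 0 → (∀ i, y i ≠ 0 → i ∈ s) →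
      mfderivWithin 𝓘(ℝ, Fin numVertices → ℝ) (𝓡 d) f (closedSimplex s) x y = 0 → y = 0

namespace Triangulation

variable {d : ℕ} {M : Type v} [TopologicalSpace M] [ChartedSpace (EuclideanSpace ℝ (Fin d)) M]
  (T : Triangulation d M)

theorem succAbove_comp_succAbove {n : ℕ} {i j : Fin (n + 2)} (h : i ≤ j) :
    j.succ.succAbove ∘ i.succAbove = i.castSucc.succAbove ∘ j.succAbove := by
  ext k
  dsimp [Fin.succAbove]
  rcases i with ⟨i, _⟩
  rcases j with ⟨j, _⟩
  rcases k with ⟨k, _⟩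
  split_ifs <;> · simp at * <;> lia

/-- The `n`-simplices of the triangulation, with vertices in increasing order. -/
def Simplex (n : ℕ) : Type :=
  {σ : Fin (n + 1) ↪o Fin T.numVertices // Finset.univ.map σ.toEmbedding ∈ T.complex.faces}

/-- The face of a simplex opposite to its `i`-th vertex. -/
def Simplex.face {n : ℕ} (i : Fin (n + 2)) (σ : T.Simplex (n + 1)) : T.Simplex n :=
  ⟨i.succAboveOrderEmb.trans σ.1, by
    refine (T.complex.isRelLowerSet_faces σ.2).2 ?_ (by simp)
    intro x hx
    simp only [Finset.mem_map, Finset.mem_univ, true_and] at hx ⊢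
    obtain ⟨j, rfl⟩ := hx
    exact ⟨i.succAbove j, rfl⟩⟩

theorem Simplex.face_face {n : ℕ} (σ : T.Simplex (n + 2)) (i j : Fin (n + 2)) (h : i ≤ j) :
    Simplex.face T i (Simplex.face T j.succ σ) = Simplex.face T j (Simplex.face T i.castSucc σ) := by
  apply Subtype.ext
  apply RelEmbedding.ext
  intro k
  exact congrArg σ.1 (congrFun (succAbove_comp_succAbove h) k)

theorem map_mem_realization {n : ℕ} (σ : T.Simplex n) (t : stdSimplex ℝ (Fin (n + 1))) :
    (stdSimplex.map σ.1 t).1 ∈ realization T.complex := by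
  refine ⟨_, σ.2, (stdSimplex.map σ.1 t).2, fun i hi => ?_⟩
  by_contra h
  refine hi ?_
  change FunOnFinite.linearMap ℝ ℝ σ.1 t i = 0
  rw [FunOnFinite.linearMap_apply_apply]
  refine Finset.sum_eq_zero fun j hj => ?_
  exact absurd (Finset.mem_map.2 ⟨j, Finset.mem_univ _, (Finset.mem_filter.1 hj).2⟩) h

/-- The characteristic map `Δⁿ → M` of a simplex. -/
def charMap {n : ℕ} (σ : T.Simplex n) : C(stdSimplex ℝ (Fin (n + 1)), M) where
  toFun t := T.homeo ⟨(stdSimplex.map σ.1 t).1, T.map_mem_realization σ t⟩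
  continuous_toFun := T.homeo.continuous.comp
    ((continuous_subtype_val.comp (stdSimplex.continuous_map _)).subtype_mk _)

/-- The inclusion of the `i`-th face of the standard simplex. -/
def faceInclusion {n : ℕ} (i : Fin (n + 2)) :
    C(stdSimplex ℝ (Fin (n + 1)), stdSimplex ℝ (Fin (n + 2))) :=
  ⟨stdSimplex.map i.succAbove, stdSimplex.continuous_map _⟩

theorem charMap_face {n : ℕ} (i : Fin (n + 2)) (σ : T.Simplex (n + 1)) :
    T.charMap (Simplex.face T i σ) = (T.charMap σ).comp (faceInclusion i) := by
  ext t
  refine congrArg T.homeo (Subtype.ext ?_)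
  exact congrArg (fun y : stdSimplex ℝ (Fin T.numVertices) => y.1)
    (stdSimplex.map_comp_apply i.succAbove σ.1 t).symm

/-- The simplices of the triangulation of `M`, with their faces. -/
def deltaSet : DeltaSet.{0} where
  simplex := T.Simplex
  face := Simplex.face T
  face_face := Simplex.face_face T

/-- The Euler characteristic of the triangulated manifold `M`, `χ(M) = ∑ (-1)ⁱ rank H_i(M; ℤ)`. -/
def eulerCharacteristic : ℤ := T.deltaSet.chainComplex.homologyEulerChar

section Lifts

variable [LocallyPathConnectedSpace M] {x₀ : M} (U : UniversalCover.{v, w} M x₀)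

/-- The `n`-simplices of the lifted triangulation of the universal cover: lifts of the
characteristic maps of the `n`-simplices of `M`. -/
@[ext] structure LiftedSimplex (n : ℕ) where
  /-- The simplex of `M` that is lifted. -/
  simplex : T.Simplex n
  /-- The lift. -/
  lift : C(stdSimplex ℝ (Fin (n + 1)), U.space)
  proj_comp_lift : U.proj ∘ lift = T.charMap simplex

/-- The fundamental group acts on the lifted simplices by deck transformations. -/
instance (n : ℕ) : MulAction (PiOne M x₀) (T.LiftedSimplex U n) where
  smul γ τ := ⟨τ.simplex, (U.deck γ).comp τ.lift, by
    rw [ContinuousMap.coe_comp, ← Function.comp_assoc, U.proj_comp_deck, τ.proj_comp_lift]⟩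
  one_smul τ := LiftedSimplex.ext rfl (by
    change (U.deck 1).comp τ.lift = τ.lift
    rw [U.deck_one, ContinuousMap.id_comp])
  mul_smul γ γ' τ := LiftedSimplex.ext rfl (by
    change (U.deck (γ * γ')).comp τ.lift = (U.deck γ).comp ((U.deck γ').comp τ.lift)
    rw [U.deck_mul, ContinuousMap.comp_assoc])

/-- The lifted triangulation of the universal cover, with the action of the fundamental group. -/
def liftedDeltaSet : EquivariantDeltaSet.{w} (PiOne M x₀) where
  simplex := T.LiftedSimplex U
  face i τ := ⟨Simplex.face T i τ.simplex, τ.lift.comp (faceInclusion i), by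
    rw [T.charMap_face, ContinuousMap.coe_comp, ← Function.comp_assoc, τ.proj_comp_lift]
    rfl⟩
  face_face τ i j h := LiftedSimplex.ext (Simplex.face_face T τ.simplex i j h) (by
    ext t
    refine congrArg τ.lift ?_
    change stdSimplex.map _ (stdSimplex.map _ t) = stdSimplex.map _ (stdSimplex.map _ t)
    rw [stdSimplex.map_comp_apply, stdSimplex.map_comp_apply]
    exact congrArg (fun φ => stdSimplex.map φ t) (succAbove_comp_succAbove h))
  action _ := inferInstance
  face_smul _ _ _ := rfl

end Lifts

variable {x₀ : M} (U : UniversalCover.{v, w} M x₀)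

/-- The complex `C_•(M, u) = Λ_u ⊗_Λ C_•(M)`, where `C_•(M)` is the complex of the lifted
triangulation of the universal cover, over the group ring `Λ = ℤ[π₁(M)]`. -/
def novikovComplex (u : PiOne M x₀ →* Multiplicative ℝ) :
    ChainComplex (ModuleCat.{max v w} (NovikovRing u)) ℕ :=
  haveI : LocallyPathConnectedSpace M :=
    ChartedSpace.locallyPathConnectedSpace (EuclideanSpace ℝ (Fin d)) M
  (T.liftedDeltaSet U).completedChainComplex u

/-- The Novikov homology `H_i(M, u)`. -/
def novikovHomology (u : PiOne M x₀ →* Multiplicative ℝ) (i : ℕ) :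
    ModuleCat.{max v w} (NovikovRing u) :=
  (T.novikovComplex U u).homology i

end Triangulation

end Triangulation

end Novikov

end

open scoped Manifold ContDiff

/-! The ring `Λ_u` is noncommutative, and trace takes over the role of rank. The coefficient of the
identity is an additive map `τ : Λ_u → ℤ` with `τ 1 = 1` and `τ(ab) = τ(ba)`; summing `τ` over
diagonal entries gives a cyclic trace on finitely generated free `Λ_u`-modules whose value on the
identity is the number of basis elements.

Deck transformations act freely on the lifted simplices, with the simplices of `M` as orbits, so
`C_n(M, u)` is free on the `c_n` simplices of `M` of dimension `n` (`exists_liftedSimplex_equiv`,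
`freeActionBasis`). An acyclic complex of free modules in degrees `≥ 0` is contractible: `1 = dh +
hd`. Let `r_n` be the trace of `dh` on `C_n`. By cyclicity it is also the trace of `hd` on
`C_{n+1}`, hence `c_n = r_n + r_{n-1}` and `∑ (-1)^n c_n` telescopes to zero
(`sum_range_card_eq_zero_of_acyclic`). By Euler–Poincaré over `ℤ` this sum is `χ(M)`
(`eulerCharacteristic_eq_sum_card`). -/

noncomputable section

namespace Novikov

/-! ### Base change of permutation modules of free `G`-sets -/

section BaseChange

open TensorProduct

namespace BaseChange

variable {R S : Type*} [Ring R] [Ring S] (f : R →+* S) {C N : Type*} [AddCommGroup C] [Module R C]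
  [AddCommGroup N] [Module S N]

/-- The `S`-linear map `s ⊗ c ↦ s • φ(c)` induced by an `f`-semilinear map `φ`. -/
def lift (φ : C →+ N) (hφ : ∀ (r : R) (c : C), φ (r • c) = f r • φ c) :
    BaseChange f C →ₗ[S] N :=
  (balancingRelations f C).liftQ
    (TensorProduct.AlgebraTensorModule.lift
      (LinearMap.toSpanSingleton S (C →ₗ[ℤ] N) φ.toIntLinearMap)) (by
    refine Submodule.span_le.2 ?_
    rintro _ ⟨s, r, c, rfl⟩
    simp [hφ, mul_smul])

theorem lift_tmul (φ : C →+ N) (hφ : ∀ (r : R) (c : C), φ (r • c) = f r • φ c) (s : S) (c : C) :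
    lift f φ hφ (tmul f s c) = s • φ c := rfl

theorem smul_tmul (s t : S) (c : C) : s • tmul f t c = tmul f (s * t) c := rfl

theorem tmul_smul (s : S) (r : R) (c : C) : tmul f s (r • c) = tmul f (s * f r) c :=
  ((Submodule.Quotient.eq (balancingRelations f C)).2 (Submodule.subset_span ⟨s, r, c, rfl⟩)).symm

/-- `c ↦ s ⊗ c` as a homomorphism of groups. -/
def tmulHom (s : S) : C →+ BaseChange f C :=
  (balancingRelations f C).mkQ.toAddMonoidHom.comp (TensorProduct.mk ℤ S C s).toAddMonoidHom

theorem tmulHom_apply (s : S) (c : C) : tmulHom f s c = tmul f s c := rfl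

end BaseChange

section FreeAction

variable {G X ι S : Type*} [Group G] [MulAction G X] [Ring S] (f : MonoidAlgebra ℤ G →+* S)

/-- The basis element `x` of the permutation module of a `G`-set. -/
def permRepOf (G : Type*) [Group G] {X : Type*} [MulAction G X] (x : X) :
    (permRep G X).asModule :=
  (permRep G X).asModuleEquiv.symm (Finsupp.single x 1)

theorem single_smul_permRepOf (g : G) (x : X) :
    (MonoidAlgebra.single g (1 : ℤ)) • permRepOf G x = permRepOf G (g • x) := by
  apply (permRep G X).asModuleEquiv.injective
  rw [Representation.asModuleEquiv_map_smul, Representation.asAlgebraHom_single_one]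
  simp only [permRepOf, LinearEquiv.apply_symm_apply]
  exact Finsupp.mapDomain_single

/-- Stated for additive maps, since the maps compared below go to `S`-modules and are at best
semilinear along `f`. -/
theorem permRep_addHom_ext {N : Type*} [AddCommGroup N] {φ ψ : (permRep G X).asModule →+ N}
    (h : ∀ x, φ (permRepOf G x) = ψ (permRepOf G x)) : φ = ψ := by
  refine Finsupp.addHom_ext' (M := ℤ) (N := N) fun x => ?_
  refine AddMonoidHom.ext_int ?_
  exact h x

/-- The homomorphism from a permutation module given by its values on the basis. -/
def permRepLift {N : Type*} [AddCommGroup N] (F : X → N) : (permRep G X).asModule →+ N :=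
  ((Finsupp.linearCombination ℤ F) ∘ₗ (permRep G X).asModuleEquiv.toLinearMap).toAddMonoidHom

theorem permRepLift_of {N : Type*} [AddCommGroup N] (F : X → N) (x : X) :
    permRepLift (G := G) F (permRepOf G x) = F x := by
  simp [permRepLift, permRepOf]

/-- For `r` a group element, both sides are additive in `c` and agree on the basis by `hF`; general
`r` follows by additivity. This is the semilinearity that `BaseChange.lift` requires. -/
theorem permRepLift_smul {N : Type*} [AddCommGroup N] [Module S N] (F : X → N)
    (hF : ∀ (g : G) (x : X), F (g • x) = f (MonoidAlgebra.single g 1) • F x)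
    (r : MonoidAlgebra ℤ G) (c : (permRep G X).asModule) :
    permRepLift (G := G) F (r • c) = f r • permRepLift (G := G) F c := by
  have key : ∀ g : G, permRepLift (G := G) F (MonoidAlgebra.single g (1 : ℤ) • c) =
      f (MonoidAlgebra.single g 1) • permRepLift (G := G) F c := by
    intro g
    have := permRep_addHom_ext (G := G) (X := X)
      (φ := (permRepLift (G := G) F).comp
        (DistribSMul.toAddMonoidHom _ (MonoidAlgebra.single g (1 : ℤ))))
      (ψ := (DistribSMul.toAddMonoidHom N (f (MonoidAlgebra.single g 1))).comp
        (permRepLift (G := G) F)) (fun x => by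
          simp only [AddMonoidHom.comp_apply, DistribSMul.toAddMonoidHom_apply,
            single_smul_permRepOf, permRepLift_of, hF])
    exact DFunLike.congr_fun this c
  induction r using MonoidAlgebra.induction_linear with
  | zero => simp
  | add a b ha hb => simp [add_smul, ha, hb]
  | single g n =>
    have : (MonoidAlgebra.single g n : MonoidAlgebra ℤ G) = n • MonoidAlgebra.single g 1 := by
      simp
    rw [this, map_zsmul, smul_assoc, map_zsmul, key, smul_assoc]

/-- If `X` is a free `G`-set with orbit space `ι`, then `S ⊗ ℤ[X]` is a free module on `ι`. -/
def freeActionBasis (e : X ≃ G × ι) (he : ∀ (g : G) (x : X), e (g • x) = (g * (e x).1, (e x).2)) :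
    Module.Basis ι S (BaseChange f (permRep G X).asModule) :=
  -- With `e.symm (1, i)` as representative of the orbit `i`, the element `g • e.symm (1, i)` goes
  -- to `f(g)` times the `i`-th basis vector.
  have hφ := permRepLift_smul f
    (fun x : X => Finsupp.single (e x).2 (f (MonoidAlgebra.single (e x).1 1))) (fun g x => by
      simp only [he, Finsupp.smul_single, smul_eq_mul, ← map_mul, MonoidAlgebra.single_mul_single,
        one_mul])
  have hsymm (g : G) (i : ι) : e.symm (g, i) = g • e.symm (1, i) := by
    apply e.injective
    simp [he]
  Module.Basis.ofRepr <| LinearEquiv.ofLinearMap (BaseChange.lift f _ hφ)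
    (Finsupp.linearCombination S fun i => BaseChange.tmul f 1 (permRepOf G (e.symm (1, i))))
    (by
      refine Finsupp.lhom_ext' fun i => LinearMap.ext_ring ?_
      simp [BaseChange.lift_tmul, permRepLift_of, ← MonoidAlgebra.one_def])
    (by
      refine BaseChange.hom_ext f fun s c => ?_
      -- Since `s ⊗ c = s • (1 ⊗ c)`, it is enough to treat `s = 1`, where both sides are additive
      -- in `c`.
      rw [LinearMap.comp_apply, BaseChange.lift_tmul, map_smul, LinearMap.id_apply,
        ← mul_one s, ← BaseChange.smul_tmul, mul_one]
      congr 1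
      refine DFunLike.congr_fun (permRep_addHom_ext (φ := AddMonoidHom.comp
        (Finsupp.linearCombination S fun i =>
          BaseChange.tmul f 1 (permRepOf G (e.symm (1, i)))).toAddMonoidHom
        (permRepLift fun x : X => Finsupp.single (e x).2 (f (MonoidAlgebra.single (e x).1 1))))
        (ψ := BaseChange.tmulHom f 1) fun x => ?_) c
      simp only [AddMonoidHom.comp_apply, permRepLift_of, LinearMap.toAddMonoidHom_coe,
        Finsupp.linearCombination_single, BaseChange.tmulHom_apply, BaseChange.smul_tmul]
      -- The group element crosses the tensor sign: `f(g) ⊗ xᵢ = 1 ⊗ g xᵢ`, and `g xᵢ = x`.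
      rw [mul_one, ← one_mul (f _), ← BaseChange.tmul_smul, single_smul_permRepOf, ← hsymm]
      simp)

end FreeAction

end BaseChange

/-! ### Traces over noncommutative rings -/

section Trace

variable {S A : Type*} [Ring S] [AddCommGroup A] (τ : S →+ A)
  {ι κ M N : Type*} [Fintype ι] [Fintype κ] [AddCommGroup M] [Module S M] [AddCommGroup N]
  [Module S N]

/-- The trace of an endomorphism of a finitely generated free module over a ring `S` that need not be
commutative, with values in an abelian group to which `S` maps. -/
def traceWith (b : Module.Basis ι S M) (φ : M →ₗ[S] M) : A := ∑ i, τ (b.repr (φ (b i)) i)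

theorem traceWith_add (b : Module.Basis ι S M) (φ ψ : M →ₗ[S] M) :
    traceWith τ b (φ + ψ) = traceWith τ b φ + traceWith τ b ψ := by
  simp [traceWith, Finset.sum_add_distrib]

theorem traceWith_id (b : Module.Basis ι S M) :
    traceWith τ b LinearMap.id = Fintype.card ι • τ 1 := by
  simp [traceWith]

/-- Both traces are double sums of `τ` over products of one matrix entry of `φ` and one of `ψ`, in
opposite orders; `hτ` absorbs the difference. -/
theorem traceWith_comp_comm (hτ : ∀ s t, τ (s * t) = τ (t * s)) (b : Module.Basis ι S M)
    (c : Module.Basis κ S N) (φ : M →ₗ[S] N) (ψ : N →ₗ[S] M) :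
    traceWith τ b (ψ ∘ₗ φ) = traceWith τ c (φ ∘ₗ ψ) := by
  have h1 (i : ι) : b.repr (ψ (φ (b i))) i =
      ∑ j, c.repr (φ (b i)) j * b.repr (ψ (c j)) i := by
    conv_lhs => rw [← c.sum_repr (φ (b i))]
    simp only [map_sum, map_smul, Finsupp.finsetSum_apply, Finsupp.smul_apply, smul_eq_mul]
  have h2 (j : κ) : c.repr (φ (ψ (c j))) j =
      ∑ i, b.repr (ψ (c j)) i * c.repr (φ (b i)) j := by
    conv_lhs => rw [← b.sum_repr (ψ (c j))]
    simp only [map_sum, map_smul, Finsupp.finsetSum_apply, Finsupp.smul_apply, smul_eq_mul]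
  simp only [traceWith, LinearMap.comp_apply, h1, h2, map_sum]
  rw [Finset.sum_comm]
  exact Finset.sum_congr rfl fun j _ => Finset.sum_congr rfl fun i _ => hτ _ _

end Trace

/-! ### The trace on the Novikov ring -/

namespace NovikovRing

variable {G : Type*} [Group G] {u : G →* Multiplicative ℝ}

/-- The coefficient of the identity element. -/
def identityCoeff (u : G →* Multiplicative ℝ) : NovikovRing u →+ ℤ where
  toFun a := a.coeff 1
  map_zero' := rfl
  map_add' _ _ := rfl

theorem identityCoeff_one : identityCoeff u 1 = 1 := coeff_single_self (u := u) 1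

/-- The left side is `∑ a(g) b(g⁻¹)`; the substitution `g ↦ g⁻¹` exchanges the roles of `a` and `b`.
-/
theorem identityCoeff_mul_comm (a b : NovikovRing u) :
    identityCoeff u (a * b) = identityCoeff u (b * a) := by
  change (a * b).coeff 1 = (b * a).coeff 1
  rw [coeff_mul, coeff_mul, ← finsum_comp_equiv (Equiv.inv G)]
  exact finsum_congr fun g => by simp [mul_comm]

end NovikovRing

/-! ### Euler characteristics of chain complexes -/

section EulerCharacteristic

open CategoryTheory Limits ZeroObject

/-- Serves twice: with `r n` the rank of `d : C_{n+1} → C_n` and `h` the ranks of homology, and with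
`r n` the trace of `dh` on `C_n` and `h = 0`. -/
theorem sum_range_alternating_telescope {c h r : ℕ → ℤ} (h0 : c 0 = h 0 + r 0)
    (hs : ∀ n, c (n + 1) = h (n + 1) + r (n + 1) + r n) (N : ℕ) :
    ∑ n ∈ Finset.range (N + 1), (-1) ^ n * c n =
      ∑ n ∈ Finset.range (N + 1), (-1) ^ n * h n + (-1) ^ N * r N := by
  induction N with
  | zero => simp [h0]
  | succ N ih =>
    rw [Finset.sum_range_succ, ih, Finset.sum_range_succ _ (N + 1), hs, pow_succ]
    ring

/-- An acyclic non-negatively graded complex of projective objects is contractible. -/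
theorem nonempty_homotopy_id_zero {𝒜 : Type*} [Category 𝒜] [Abelian 𝒜] (C : ChainComplex 𝒜 ℕ)
    (hproj : ∀ n, Projective (C.X n)) (hC : ∀ n, IsZero (C.homology n)) :
    Nonempty (Homotopy (𝟙 C) 0) := by
  have hex (n : ℕ) : C.ExactAt n := (C.exactAt_iff_isZero_homology n).2 (hC n)
  -- An acyclic `C` is a projective resolution of the zero object. The identity of `C` then lifts a
  -- zero map, and such lifts are null-homotopic.
  let P : ProjectiveResolution (0 : 𝒜) :=
    { complex := C
      projective := hproj
      π := 0
      quasiIso := by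
        rw [quasiIso_iff]
        intro n
        refine (quasiIsoAt_iff_exactAt _ n (hex n)).2 ?_
        rw [HomologicalComplex.exactAt_iff_isZero_homology]
        refine IsZero.of_iso (isZero_zero _) ((HomologicalComplex.homologyFunctor _ _ n).mapIso
          (((ChainComplex.single₀ 𝒜).map_isZero (isZero_zero 𝒜)).isoZero) ≪≫
            ((HomologicalComplex.homologyFunctor 𝒜 _ n).map_isZero (isZero_zero _)).isoZero) }
  exact ⟨ProjectiveResolution.liftHomotopyZero (P := P) (Q := P) (𝟙 C) comp_zero⟩

/-- An acyclic bounded complex of finitely generated free modules over a ring with a trace that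
takes the value `1` at `1` has Euler characteristic zero. -/
theorem sum_range_card_eq_zero_of_acyclic {S : Type*} [Ring S] (τ : S →+ ℤ) (hτ1 : τ 1 = 1)
    (hτ : ∀ s t, τ (s * t) = τ (t * s)) (C : ChainComplex (ModuleCat S) ℕ) {ι : ℕ → Type*}
    [∀ n, Fintype (ι n)] (b : ∀ n, Module.Basis (ι n) S (C.X n))
    (hC : ∀ n, IsZero (C.homology n)) (N : ℕ) [IsEmpty (ι N)] :
    ∑ n ∈ Finset.range (N + 1), (-1 : ℤ) ^ n * Fintype.card (ι n) = 0 := by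
  obtain ⟨H⟩ := nonempty_homotopy_id_zero C (fun n => ModuleCat.projective_of_free (b n)) hC
  have hid (n : ℕ) : traceWith τ (b n) (𝟙 (C.X n) : C.X n ⟶ C.X n).hom = Fintype.card (ι n) := by
    simpa [hτ1] using traceWith_id τ (b n)
  let r (n : ℕ) : ℤ := traceWith τ (b n) (H.hom n (n + 1) ≫ C.d (n + 1) n).hom
  have h0 : (Fintype.card (ι 0) : ℤ) = 0 + r 0 := by
    have := H.comm 0
    simp only [HomologicalComplex.id_f, HomologicalComplex.zero_f, add_zero,
      Homotopy.dNext_zero_chainComplex, Homotopy.prevD_chainComplex, zero_add] at this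
    rw [← hid, this, zero_add (r 0)]
  have hs (n : ℕ) : (Fintype.card (ι (n + 1)) : ℤ) = 0 + r (n + 1) + r n := by
    have := H.comm (n + 1)
    simp only [HomologicalComplex.id_f, HomologicalComplex.zero_f, add_zero,
      Homotopy.dNext_succ_chainComplex, Homotopy.prevD_chainComplex] at this
    rw [← hid, this, ModuleCat.hom_add, traceWith_add, zero_add, add_comm]
    congr 1
    -- Cyclicity turns the trace of `hd` on `C_{n+1}` into that of `dh` on `C_n`.
    exact traceWith_comp_comm τ hτ _ _ _ _
  -- The basis in degree `N` is empty, so the boundary term of the telescope vanishes.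
  have hN : r N = 0 := by simp [r, traceWith]
  have := sum_range_alternating_telescope (c := fun n => Fintype.card (ι n)) (h := fun _ => 0) h0 hs N
  simpa [hN] using this

/-- The homological Euler characteristic of a bounded complex of finitely generated modules over
a Noetherian domain is the alternating sum of their ranks. -/
theorem homologyEulerChar_eq_sum_range {R : Type*} [CommRing R] [IsDomain R] [IsNoetherianRing R]
    (C : ChainComplex (ModuleCat R) ℕ)
    [∀ n, Module.Finite R (C.X n)] (N : ℕ) (hN : ∀ n, N ≤ n → Subsingleton (C.X n)) :
    C.homologyEulerChar =
      ∑ n ∈ Finset.range (N + 1), (-1 : ℤ) ^ n * Module.finrank R (C.X n) := by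
  have hH (n : ℕ) (h : N ≤ n) : Module.finrank R (C.homology n) = 0 := by
    have := hN n h
    have hz : IsZero (C.X n) := ModuleCat.isZero_of_subsingleton _
    have : Subsingleton (C.homology n) :=
      ModuleCat.subsingleton_of_isZero (ShortComplex.isZero_homology_of_isZero_X₂ _ hz)
    exact Module.finrank_zero_of_subsingleton
  rw [HomologicalComplex.homologyEulerChar_eq_sum_finSet_of_finrankSupport_subset C
    (Finset.range (N + 1)) ?_]
  swap
  · intro n hn
    by_contra h
    exact hn (hH n (by simp at h; omega))
  let r (n : ℕ) : ℤ := Module.finrank R (C.d (n + 1) n).hom.range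
  -- Rank-nullity twice: `C_n` splits into cycles and the image of the outgoing map, cycles into
  -- homology and the image of the incoming map.
  have hsc (n : ℕ) : (Module.finrank R (C.X n) : ℤ) = Module.finrank R (C.homology n) +
      Module.finrank R (C.sc n).f.hom.range + Module.finrank R (C.sc n).g.hom.range := by
    have : Module.Finite R (C.sc n).X₂ := inferInstanceAs (Module.Finite R (C.X n))
    have e : Module.finrank R (C.homology n) = Module.finrank R
        ((C.sc n).g.hom.ker ⧸ (C.sc n).moduleCatToCycles.range) :=
      (C.sc n).moduleCatHomologyIso.toLinearEquiv.finrank_eq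
    have h1 := Submodule.finrank_quotient_add_finrank (R := R) (C.sc n).moduleCatToCycles.range
    have h2 : _ = Module.finrank R (C.X n) :=
      Submodule.finrank_quotient_add_finrank (R := R) (C.sc n).g.hom.ker
    have h3 := (C.sc n).g.hom.quotKerEquivRange.finrank_eq
    have h4 : Module.finrank R (C.sc n).f.hom.range =
        Module.finrank R (C.sc n).moduleCatToCycles.range := by
      have hcomp : (C.sc n).f.hom = (C.sc n).g.hom.ker.subtype ∘ₗ (C.sc n).moduleCatToCycles := rfl
      rw [hcomp, LinearMap.range_comp]
      exact Submodule.finrank_map_subtype_eq _ _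
    omega
  have hf (n : ℕ) : (Module.finrank R (C.sc n).f.hom.range : ℤ) = r n := by
    change ((Module.finrank R (C.d ((ComplexShape.down ℕ).prev n) n).hom.range : ℕ) : ℤ) = _
    rw [ChainComplex.prev]
  have hg (n : ℕ) : (Module.finrank R (C.sc (n + 1)).g.hom.range : ℤ) = r n := by
    change ((Module.finrank R
      (C.d (n + 1) ((ComplexShape.down ℕ).next (n + 1))).hom.range : ℕ) : ℤ) = _
    rw [ChainComplex.next_nat_succ]
  -- `next 0` takes the default value `0`, so the outgoing map in degree `0` is `d 0 0`, which is
  -- zero as `0` is not related to itself.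
  have hg0 : (Module.finrank R (C.sc 0).g.hom.range : ℤ) = 0 := by
    change ((Module.finrank R (C.d 0 ((ComplexShape.down ℕ).next 0)).hom.range : ℕ) : ℤ) = _
    rw [ChainComplex.next_nat_zero, C.shape 0 0 (by simp), ModuleCat.hom_zero, LinearMap.range_zero, finrank_bot, Nat.cast_zero]
  have hr : r N = 0 := by
    have := hN N le_rfl
    have : Subsingleton (C.d (N + 1) N).hom.range := inferInstance
    simp [r, Module.finrank_zero_of_subsingleton]
  have := sum_range_alternating_telescope (c := fun n => Module.finrank R (C.X n))
    (h := fun n => Module.finrank R (C.homology n)) (r := r) (by simp [hsc, hf, hg0])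
    (fun n => by simp [hsc, hf, hg]) N
  rw [this, hr]
  simp

end EulerCharacteristic

universe v w

/-! ### The deck group acts simply transitively on fibres -/

namespace UniversalCover

variable {X : Type v} [TopologicalSpace X] {x₀ : X} (U : UniversalCover.{v, w} X x₀)

/-- Lifts with the same end point are homotopic by simple connectedness, and the homotopy projects
to `X`. -/
theorem endpoint_injective : Function.Injective U.endpoint := by
  rintro ⟨⟨p⟩⟩ ⟨⟨q⟩⟩ h
  have hp := p.source.trans U.proj_base.symm
  have hq := q.source.trans U.proj_base.symm
  let P : Path U.base (U.isCoveringMap.liftPath q U.base hq 1) :=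
    ⟨U.isCoveringMap.liftPath p U.base hp, U.isCoveringMap.liftPath_zero _ _ _, h⟩
  let Q : Path U.base (U.isCoveringMap.liftPath q U.base hq 1) :=
    ⟨U.isCoveringMap.liftPath q U.base hq, U.isCoveringMap.liftPath_zero _ _ _, rfl⟩
  have hPQ := (U.isCoveringMap.homotopicRel_iff_comp
    ⟨0, .inl rfl, P.source.trans Q.source.symm⟩).mp (SimplyConnectedSpace.paths_homotopic P Q)
  have hP : ContinuousMap.comp ⟨U.proj, U.isCoveringMap.continuous⟩ P.toContinuousMap =
      p.toContinuousMap := DFunLike.coe_injective (U.isCoveringMap.liftPath_lifts _ _ hp)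
  have hQ : ContinuousMap.comp ⟨U.proj, U.isCoveringMap.continuous⟩ Q.toContinuousMap =
      q.toContinuousMap := DFunLike.coe_injective (U.isCoveringMap.liftPath_lifts _ _ hq)
  rw [hP, hQ] at hPQ
  exact congrArg MulOpposite.op (Quotient.sound hPQ)

/-- A path from the base point to `e` projects to a loop, and is itself the lift of that loop. -/
theorem exists_endpoint_eq {e : U.space} (he : U.proj e = x₀) : ∃ γ, U.endpoint γ = e := by
  obtain ⟨p⟩ := PathConnectedSpace.joined U.base e
  let q : Path x₀ x₀ := (p.map U.isCoveringMap.continuous).cast U.proj_base.symm he.symm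
  refine ⟨⟨Path.Homotopic.Quotient.mk q⟩, ?_⟩
  change U.isCoveringMap.liftPath q U.base _ 1 = e
  have : p.toContinuousMap = U.isCoveringMap.liftPath q U.base (q.source.trans U.proj_base.symm) := by
    rw [U.isCoveringMap.eq_liftPath_iff']
    exact ⟨rfl, p.source⟩
  rw [← this]
  exact p.target

variable [LocallyPathConnectedSpace X]

/-- The lifting criterion gives a map over `X` taking `e` to `e'`. It is the deck transformation of
any loop whose lift ends at the image of the base point. -/
theorem exists_deck_eq {e e' : U.space} (h : U.proj e = U.proj e') : ∃ γ, U.deck γ e = e' := by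
  obtain ⟨F, ⟨hF, hp⟩, -⟩ := U.isCoveringMap.existsUnique_continuousMap_lifts
    ⟨U.proj, U.isCoveringMap.continuous⟩ e e' h.symm
  obtain ⟨γ, hγ⟩ := U.exists_endpoint_eq (e := F U.base)
    ((congrFun hp U.base).trans U.proj_base)
  exact ⟨γ, by rw [← U.eq_deck hγ.symm hp, hF]⟩

/-- Two lifts of `proj` that agree at one point agree everywhere, in particular at the base point.
-/
theorem eq_of_deck_eq {γ γ' : PiOne X x₀} {e : U.space} (h : U.deck γ e = U.deck γ' e) :
    γ = γ' := by
  have := U.isCoveringMap.eq_of_comp_eq (U.deck γ).continuous (U.deck γ').continuous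
    ((U.proj_comp_deck γ).trans (U.proj_comp_deck γ').symm) e h
  apply U.endpoint_injective
  rw [← U.deck_base, ← U.deck_base, this]

end UniversalCover

/-! ### Lifted simplices as a free `π₁`-set -/

namespace Triangulation

variable {d : ℕ} {M : Type v} [TopologicalSpace M] [ChartedSpace (EuclideanSpace ℝ (Fin d)) M]
  (T : Triangulation d M) {x₀ : M} (U : UniversalCover.{v, w} M x₀)

instance (n : ℕ) : Finite (T.Simplex n) :=
  inferInstanceAs (Finite {σ : Fin (n + 1) ↪o Fin T.numVertices //
    Finset.univ.map σ.toEmbedding ∈ T.complex.faces})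

instance (n : ℕ) : Fintype (T.Simplex n) := Fintype.ofFinite _

theorem isEmpty_simplex {n : ℕ} (h : T.numVertices ≤ n) : IsEmpty (T.Simplex n) :=
  ⟨fun σ => by
    have := Fintype.card_le_of_embedding σ.1.toEmbedding
    simp only [Fintype.card_fin] at this
    omega⟩

/-- Surjectivity is not part of `UniversalCover`; it comes from lifting paths that start at `x₀`. -/
theorem proj_surjective [ConnectedSpace M] [LocallyPathConnectedSpace M] :
    Function.Surjective U.proj := by
  have : PathConnectedSpace M := pathConnectedSpace_iff_connectedSpace.2 inferInstance
  intro x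
  obtain ⟨p⟩ := PathConnectedSpace.joined x₀ x
  obtain ⟨Γ, hΓ, -⟩ := U.isCoveringMap.exists_path_lifts p U.base (p.source.trans U.proj_base.symm)
  exact ⟨Γ 1, (congrFun hΓ 1).trans p.target⟩

/-- The standard simplex is convex, hence contractible and locally path connected, so the lifting
criterion applies. -/
theorem exists_liftedSimplex [ConnectedSpace M] [LocallyPathConnectedSpace M] {n : ℕ}
    (σ : T.Simplex n) : ∃ τ : T.LiftedSimplex U n, τ.simplex = σ := by
  have hconv := convex_stdSimplex ℝ (Fin (n + 1))
  have : LocallyPathConnectedSpace (stdSimplex ℝ (Fin (n + 1))) := hconv.locallyPathConnectedSpace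
  have : ContractibleSpace (stdSimplex ℝ (Fin (n + 1))) :=
    hconv.contractibleSpace ⟨_, single_mem_stdSimplex ℝ 0⟩
  let v : stdSimplex ℝ (Fin (n + 1)) := ⟨_, single_mem_stdSimplex ℝ 0⟩
  obtain ⟨e, he⟩ := proj_surjective U (T.charMap σ v)
  obtain ⟨F, ⟨-, hF⟩, -⟩ := U.isCoveringMap.existsUnique_continuousMap_lifts (T.charMap σ) v e he
  exact ⟨⟨σ, F, hF⟩, rfl⟩

variable [LocallyPathConnectedSpace M]

/-- Evaluation at a vertex reduces this to simple transitivity on fibres, since lifts of one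
characteristic map are determined by their value at a point. -/
theorem existsUnique_smul_eq {n : ℕ} (τ τ' : T.LiftedSimplex U n) (h : τ.simplex = τ'.simplex) :
    ∃! γ : PiOne M x₀, γ • τ = τ' := by
  let v : stdSimplex ℝ (Fin (n + 1)) := ⟨_, single_mem_stdSimplex ℝ 0⟩
  have hp : U.proj ∘ τ.lift = U.proj ∘ τ'.lift := by
    rw [τ.proj_comp_lift, τ'.proj_comp_lift, h]
  obtain ⟨γ, hγ⟩ := U.exists_deck_eq (congrFun hp v)
  refine ⟨γ, LiftedSimplex.ext h ?_, fun γ' hγ' => ?_⟩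
  · refine DFunLike.coe_injective (U.isCoveringMap.eq_of_comp_eq
      ((U.deck γ).comp τ.lift).continuous τ'.lift.continuous ?_ v hγ)
    change U.proj ∘ U.deck γ ∘ τ.lift = _
    rw [← Function.comp_assoc, U.proj_comp_deck, hp]
  · refine U.eq_of_deck_eq (e := τ.lift v) (Eq.trans ?_ hγ.symm)
    exact congrArg (fun τ : T.LiftedSimplex U n => τ.lift v) hγ'

/-- The lifted simplices form a free `π₁`-set, with the simplices of `M` as orbits. -/
theorem exists_liftedSimplex_equiv [ConnectedSpace M] (n : ℕ) :
    ∃ e : T.LiftedSimplex U n ≃ PiOne M x₀ × T.Simplex n,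
      ∀ γ τ, e (γ • τ) = (γ * (e τ).1, (e τ).2) := by
  -- `l` fixes one lift of each simplex, and `g τ` is the unique element that carries the chosen
  -- lift to `τ`.
  choose l hl using T.exists_liftedSimplex U (n := n)
  choose g hg hg' using fun τ : T.LiftedSimplex U n =>
    T.existsUnique_smul_eq U (l τ.simplex) τ (hl _)
  refine ⟨⟨fun τ => (g τ, τ.simplex), fun q => q.1 • l q.2, hg, ?_⟩, ?_⟩
  · rintro ⟨γ, σ⟩
    have h1 : (γ • l σ).simplex = σ := hl σ
    refine Prod.ext (hg' _ _ ?_).symm h1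
    change γ • l (γ • l σ).simplex = _
    rw [h1]
  · intro γ τ
    refine Prod.ext (hg' _ _ ?_).symm rfl
    change (γ * g τ) • l τ.simplex = γ • τ
    rw [mul_smul]
    exact congrArg _ (hg τ)

end Triangulation

/-! ### Counting simplices on both sides -/

namespace Triangulation

variable {d : ℕ} {M : Type v} [TopologicalSpace M] [ChartedSpace (EuclideanSpace ℝ (Fin d)) M]
  (T : Triangulation d M)

/-- Euler–Poincaré over `ℤ`. An `n`-simplex has `n + 1` distinct vertices, so chains vanish from
degree `numVertices` on. -/
theorem eulerCharacteristic_eq_sum_card : T.eulerCharacteristic =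
    ∑ n ∈ Finset.range (T.numVertices + 1), (-1 : ℤ) ^ n * Fintype.card (T.Simplex n) := by
  have (n : ℕ) : Module.Finite ℤ (T.deltaSet.chainComplex.X n) :=
    inferInstanceAs (Module.Finite ℤ (T.Simplex n →₀ ℤ))
  rw [eulerCharacteristic, homologyEulerChar_eq_sum_range _ T.numVertices]
  · refine Finset.sum_congr rfl fun n _ => ?_
    congr 2
    exact Module.finrank_finsupp_self (ι := T.Simplex n) ℤ
  · intro n hn
    have := T.isEmpty_simplex hn
    exact inferInstanceAs (Subsingleton (T.Simplex n →₀ ℤ))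

theorem nonempty_novikovComplex_basis [ConnectedSpace M] {x₀ : M} (U : UniversalCover.{v, w} M x₀)
    (u : PiOne M x₀ →* Multiplicative ℝ) (n : ℕ) :
    Nonempty (Module.Basis (T.Simplex n) (NovikovRing u) ((T.novikovComplex U u).X n)) := by
  have := ChartedSpace.locallyPathConnectedSpace (EuclideanSpace ℝ (Fin d)) M
  obtain ⟨e, he⟩ := T.exists_liftedSimplex_equiv U n
  exact ⟨freeActionBasis (NovikovRing.ofGroupRing u) e he⟩

end Triangulation

end Novikov

end

theorem proposition3p5 {d : ℕ} {M : Type*} [TopologicalSpace M] [T2Space M] [CompactSpace M]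
    [ConnectedSpace M] [ChartedSpace (EuclideanSpace ℝ (Fin d)) M] [IsManifold (𝓡 d) ∞ M]
    (T : Novikov.Triangulation d M) (x₀ : M) (U : Novikov.UniversalCover M x₀)
    (u : Novikov.PiOne M x₀ →* Multiplicative ℝ)
    (h : ∀ i : ℕ, CategoryTheory.Limits.IsZero (T.novikovHomology U u i)) :
    T.eulerCharacteristic = 0 := by
  -- Supplies the empty basis in degree `numVertices` at which the telescoping stops.
  have := T.isEmpty_simplex le_rfl
  rw [T.eulerCharacteristic_eq_sum_card]
  exact Novikov.sum_range_card_eq_zero_of_acyclic (Novikov.NovikovRing.identityCoeff u)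
    Novikov.NovikovRing.identityCoeff_one Novikov.NovikovRing.identityCoeff_mul_comm
    (T.novikovComplex U u) (fun n => (T.nonempty_novikovComplex_basis U u n).some) h _
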